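/- Let $k\le n$ be integers with $k\ge 1$, and let $G$ be a simple graph on the vertex set $\{1,\dots,n+1\}$ whose edges $e$ carry weights $w_e$ in a commutative ring (for example independent indeterminates). The vertices in $[k+1]=\{1,\dots,k+1\}$ are called marked. Let $L$ be the weighted Laplacian of $G$: $L_{uv}=-w_{uv}$ for $u\ne v$ (with $w_{uv}=0$ if $uv$ is not an edge) and $L_{uu}=\sum_{x\neq u}w_{ux}$. For a matrix $M$, let $M_{U,W}$ be $M$ with the rows indexed by $U$ and the columns indexed by $W$ removed, and write $M_{i,j}=M_{\{i\},\{j\}}$. A $t$-forest is a spanning forest of $G$ with exactly $t$ trees (isolated vertices count as trees). The weight of a forest is $w(F)=\prod_{e\in F}w_e$. A pair of forests is forbidden if two distinct marked vertices lie in the same tree in both forests of the pair. Fix distinct $c,j\in[k+1]$, put $j'=j$ if $j<c$ and $j'=j-1$ if $j>c$, and let $M=L_{c,c}$, so that $j'$ is the position of the column of the vertex $j$ in $M$. The $j'$-th column expansion identity for $M$, $$\det(M)\det(M_{[k],[k]})=\sum_{i=1}^k(-1)^{i+j'}\det(M_{i,j'})\det(M_{[k]\setminus\{i\},[k]\setminus\{j'\}}),$$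 holds and has the following combinatorial interpretation. 1. The left side equals $\sum w(T)\,w(F)$ over all pairs $(T,F)$ in which $T$ is a spanning tree of $G$ and $F$ is a $(k+1)$-forest with all the marked vertices in different trees. 2. The right side equals $\sum w(F_2)\,w(F_k)$, each pair taken exactly once and with positive sign, over all non-forbidden pairs $(F_2,F_k)$ in which $F_2$ is a $2$-forest with $c$ and $j$ in different trees, and $F_k$ is a $k$-forest in which the $k$ marked vertices other than $j$ lie in different trees (so $j$ shares its tree in $F_k$ with exactly one other marked vertex). -/

import Mathlib

/-- The set `[k]` of the first `k` indices of `Fin n`. -/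
def firstIdx {k n : ℕ} (h : k ≤ n) : Finset (Fin n) :=
  Finset.univ.map (Fin.castLEEmb h)

/-- `M_{U,W}`: the rows in `U` and the columns in `W` are removed, and the remaining rows and
columns keep their order. -/
def removeRowsCols {R : Type*} {n : ℕ} (M : Matrix (Fin n) (Fin n) R) (U W : Finset (Fin n))
    (h : W.card = U.card) : Matrix (Fin Uᶜ.card) (Fin Uᶜ.card) R :=
  M.submatrix (Uᶜ.orderEmbOfFin rfl)
    (Wᶜ.orderEmbOfFin (by rw [Finset.card_compl, Finset.card_compl, h]))

theorem card_erase_firstIdx {k n : ℕ} (h : k ≤ n) (i j : Fin k) :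
    ((firstIdx h).erase (Fin.castLE h j)).card = ((firstIdx h).erase (Fin.castLE h i)).card := by
  rw [Finset.card_erase_of_mem, Finset.card_erase_of_mem] <;> simp [firstIdx]

/-- `det(M) det(M_{[k],[k]})`. -/
def columnExpansionLeft {R : Type*} [CommRing R] {k n : ℕ} (h : k ≤ n)
    (M : Matrix (Fin n) (Fin n) R) : R :=
  M.det * (removeRowsCols M (firstIdx h) (firstIdx h) rfl).det

/-- `∑_{i ∈ [k]} (-1)^{i+j} det(M_{i,j}) det(M_{[k] \ {i}, [k] \ {j}})`. Indices start at `0`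
here, which does not change the parity of `i + j`. -/
def columnExpansionRight {R : Type*} [CommRing R] {k n : ℕ} (h : k ≤ n)
    (M : Matrix (Fin n) (Fin n) R) (j : Fin k) : R :=
  ∑ i : Fin k, (-1) ^ ((i : ℕ) + (j : ℕ)) *
    (removeRowsCols M {Fin.castLE h i} {Fin.castLE h j} rfl).det *
    (removeRowsCols M ((firstIdx h).erase (Fin.castLE h i)) ((firstIdx h).erase (Fin.castLE h j))
      (card_erase_firstIdx h i j)).det

open Classical in
/-- The weight of the (undirected) edge `uv` of `G`; it is `0` if `uv` is not an edge. -/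
noncomputable def edgeWeight {V R : Type*} [Zero R] (G : SimpleGraph V) (w : Sym2 V → R)
    (u v : V) : R :=
  if G.Adj u v then w s(u, v) else 0

/-- The weighted Laplacian of `G`: the entry at `(u, v)` is minus the weight of `uv` if `u ≠ v`,
and the sum of the weights of the edges at `u` if `u = v`. -/
noncomputable def weightedLaplacian {V R : Type*} [Fintype V] [DecidableEq V] [CommRing R]
    (G : SimpleGraph V) (w : Sym2 V → R) : Matrix V V R :=
  Matrix.of fun u v =>
    if u = v then ∑ x ∈ Finset.univ.erase u, edgeWeight G w u x else -edgeWeight G w u v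

/-- `F` is a spanning forest of `G` with exactly `r` trees (isolated vertices count as trees).
Two vertices are in the same tree of `F` iff `F.Reachable` holds for them. -/
def IsSpanningForest {V : Type*} (G : SimpleGraph V) (r : ℕ) (F : SimpleGraph V) : Prop :=
  F ≤ G ∧ F.IsAcyclic ∧ Nat.card F.ConnectedComponent = r

open Classical in
/-- The product of the weights of the edges of `F`. -/
noncomputable def forestWeight {V R : Type*} [Fintype V] [CommRing R] (w : Sym2 V → R)
    (F : SimpleGraph V) : R :=
  ∏ e ∈ F.edgeFinset, w e

/-- A pair of forests is forbidden if two different marked vertices (the values of `v`) are in the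
same tree of both forests. -/
def IsForbidden {V ι : Type*} (v : ι → V) (F F' : SimpleGraph V) : Prop :=
  ∃ a b : ι, a ≠ b ∧ F.Reachable (v a) (v b) ∧ F'.Reachable (v a) (v b)

/-- The pairs of a spanning tree and a `(k+1)`-forest of `G` with the `k+1` marked vertices
in different trees. -/
def leftPairs {V : Type*} {k : ℕ} (G : SimpleGraph V) (v : Fin (k + 1) → V) :
    Set (SimpleGraph V × SimpleGraph V) :=
  {p | IsSpanningForest G 1 p.1 ∧ IsSpanningForest G (k + 1) p.2 ∧
    ∀ a b, a ≠ b → ¬ p.2.Reachable (v a) (v b)}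

/-- The non-forbidden pairs of a `2`-forest and a `k`-forest of `G` such that the marked vertices
`c` and `j` are in different trees of the `2`-forest, and the `k` marked vertices other than `j`
are in different trees of the `k`-forest (so that `j` shares its tree in the `k`-forest with
exactly one other marked vertex). -/
def rightPairs {V : Type*} {k : ℕ} (G : SimpleGraph V) (v : Fin (k + 1) → V)
    (c j : Fin (k + 1)) : Set (SimpleGraph V × SimpleGraph V) :=
  {p | IsSpanningForest G 2 p.1 ∧ IsSpanningForest G k p.2 ∧ ¬ IsForbidden v p.1 p.2 ∧
    ¬ p.1.Reachable (v c) (v j) ∧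
    ∀ a b, a ≠ j → b ≠ j → a ≠ b → ¬ p.2.Reachable (v a) (v b)}

open Classical in
/-- The generating function of a set of pairs of forests: each pair contributes the product of the
weights of its two forests. With indeterminates as weights it records the edges of both forests
with multiplicity; with all weights `1` it is the number of pairs. -/
noncomputable def pairSum {V R : Type*} [Fintype V] [CommRing R] (w : Sym2 V → R)
    (S : Set (SimpleGraph V × SimpleGraph V)) : R :=
  ∑ p : SimpleGraph V × SimpleGraph V with p ∈ S, forestWeight w p.1 * forestWeight w p.2

/-!
Expanding the determinant of a grounded Laplacian along its rows amounts to choosing a parent for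
every vertex that is not a root; the choices without a cycle contribute `1` and the others `0`.
Hence a principal minor of `L` is the sum over the forests rooted at the removed vertices, and, on
replacing a row, a minor whose sets of removed rows and columns differ in one element is, up to
sign, a sum over forests in which two given vertices share a tree.

The column expansion identity comes from `adj M * M = det M • 1`, since the minors of `M` with a
repeated row vanish. Its summand `i = j'` is the sum over all pairs of a 2-forest separating `c`
from `j` and a `k`-forest separating the marked vertices other than `j`. Its summand `i ≠ j'` is
minus the sum over those of these pairs in which the `i`-th marked vertex other than `c` is in the
tree of `j` in both forests. These pairs are forbidden. Conversely, in the `k`-forest exactly one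
marked vertex shares the tree of `j`, so each forbidden pair is cancelled by exactly one summand.
-/

/-- `f` is the parent function of a rooted forest on `V` with set of roots `S`. Roots are encoded as
their own parents. -/
structure IsParentMap {V : Type*} (S : Finset V) (f : V → V) : Prop where
  map_root : ∀ s ∈ S, f s = s
  exists_iterate_mem : ∀ u, ∃ m, f^[m] u ∈ S

section ParentMap

variable {V : Type*} {S : Finset V} {f g : V → V} {a b u : V}

theorem exists_iterate_mem_of_eqOn_compl (hfg : ∀ u ∉ S, f u = g u) (h : ∃ m, f^[m] u ∈ S) :
    ∃ m, g^[m] u ∈ S := by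
  obtain ⟨m, hm⟩ := h
  induction m generalizing u with
  | zero => exact ⟨0, hm⟩
  | succ m ih =>
    by_cases hu : u ∈ S
    · exact ⟨0, hu⟩
    · obtain ⟨l, hl⟩ := ih hm
      exact ⟨l + 1, by rwa [Function.iterate_succ_apply, ← hfg u hu]⟩

theorem exists_iterate_map_iff {P : V → Prop} (hu : P u → P (f u)) :
    (∃ m, P (f^[m] (f u))) ↔ ∃ m, P (f^[m] u) := by
  refine ⟨fun ⟨m, hm⟩ => ⟨m + 1, hm⟩, ?_⟩
  rintro ⟨_ | m, hm⟩
  · exact ⟨0, hu hm⟩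
  · exact ⟨m, hm⟩

namespace IsParentMap

theorem induction (hf : IsParentMap S f) {P : V → Prop} (root : ∀ s ∈ S, P s)
    (step : ∀ u ∉ S, P (f u) → P u) (u : V) : P u := by
  obtain ⟨m, hm⟩ := hf.exists_iterate_mem u
  induction m generalizing u with
  | zero => exact root u hm
  | succ m ih =>
    by_cases hu : u ∈ S
    · exact root u hu
    · exact step u hu (ih (f u) hm)

theorem exists_depth (hf : IsParentMap S f) : ∃ d : V → ℕ, ∀ u ∉ S, d (f u) < d u := by
  classical
  refine ⟨fun u => Nat.find (hf.exists_iterate_mem u), fun u hu => ?_⟩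
  beta_reduce
  have hm := Nat.find_spec (hf.exists_iterate_mem u)
  cases h : Nat.find (hf.exists_iterate_mem u) with
  | zero => exact absurd (by rwa [h] at hm) hu
  | succ m =>
    rw [h, Function.iterate_succ_apply] at hm
    exact Nat.lt_succ_of_le (Nat.find_min' (hf.exists_iterate_mem (f u)) hm)

theorem of_depth (map_root : ∀ s ∈ S, f s = s) (d : V → ℕ) (hd : ∀ u ∉ S, d (f u) < d u) :
    IsParentMap S f := by
  refine ⟨map_root, fun u => ?_⟩
  induction h : d u using Nat.strong_induction_on generalizing u with
  | _ l ih =>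
    by_cases hu : u ∈ S
    · exact ⟨0, hu⟩
    · obtain ⟨m, hm⟩ := ih _ (h ▸ hd u hu) (f u) rfl
      exact ⟨m + 1, hm⟩

theorem iterate_map_ne (hf : IsParentMap S f) (hu : u ∉ S) (m : ℕ) : f^[m] (f u) ≠ u := by
  obtain ⟨d, hd⟩ := hf.exists_depth
  have hle : ∀ x, d (f x) ≤ d x := fun x => by
    by_cases hx : x ∈ S
    · rw [hf.map_root x hx]
    · exact (hd x hx).le
  have hiter : d (f^[m] (f u)) ≤ d (f u) := by
    induction m with
    | zero => rfl
    | succ m ih =>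
      rw [Function.iterate_succ_apply']
      exact (hle _).trans ih
  intro h
  rw [h] at hiter
  exact (hd u hu).not_ge hiter

theorem map_ne (hf : IsParentMap S f) (hu : u ∉ S) : f u ≠ u :=
  hf.iterate_map_ne hu 0

end IsParentMap

/-- Making `a` the parent of the root `b` closes a cycle iff `a` descends from `b`. -/
theorem isParentMap_update_iff [DecidableEq V] (hbS : b ∉ S) (hgb : g b = b) :
    IsParentMap S (Function.update g b a) ↔
      IsParentMap (insert b S) g ∧ ¬ ∃ m, g^[m] a = b := by
  set h := Function.update g b a
  have hb : h b = a := Function.update_self _ _ _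
  have hne : ∀ u ≠ b, h u = g u := fun u hu => Function.update_of_ne hu _ _
  have heqOn : ∀ u ∉ insert b S, h u = g u := fun u hu => hne u fun hub => hu (by simp [hub])
  have heqOn' : ∀ u ∉ ({b} : Finset V), g u = h u := fun u hu => (hne u (by simpa using hu)).symm
  have hneS : ∀ s ∈ S, s ≠ b := fun s hs hsb => hbS (hsb ▸ hs)
  constructor
  · intro hh
    refine ⟨⟨fun s hs => ?_, fun u => ?_⟩, fun hab => ?_⟩
    · rcases Finset.mem_insert.1 hs with rfl | hs
      · exact hgb
      · rw [← hne s (hneS s hs), hh.map_root s hs]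
    · obtain ⟨m, hm⟩ := hh.exists_iterate_mem u
      exact exists_iterate_mem_of_eqOn_compl heqOn ⟨m, Finset.mem_insert_of_mem hm⟩
    · obtain ⟨m, hm⟩ := exists_iterate_mem_of_eqOn_compl heqOn' (by simpa using hab)
      exact hh.iterate_map_ne hbS m (by simpa [hb] using hm)
  · rintro ⟨hg, hab⟩
    have reach : ∀ u, ∃ m, h^[m] u ∈ insert b S := fun u =>
      exists_iterate_mem_of_eqOn_compl (fun x hx => (heqOn x hx).symm) (hg.exists_iterate_mem u)
    have reach_a : ∃ m, h^[m] a ∈ S := by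
      obtain ⟨m, hm⟩ := reach a
      refine ⟨m, (Finset.mem_insert.1 hm).resolve_left fun hmb => hab ?_⟩
      simpa using exists_iterate_mem_of_eqOn_compl (fun x hx => (heqOn' x hx).symm)
        ⟨m, Finset.mem_singleton.2 hmb⟩
    refine ⟨fun s hs => ?_, fun u => ?_⟩
    · rw [hne s (hneS s hs), hg.map_root s (Finset.mem_insert_of_mem hs)]
    · obtain ⟨m, hm⟩ := reach u
      rcases Finset.mem_insert.1 hm with hmb | hmS
      · obtain ⟨l, hl⟩ := reach_a
        refine ⟨l + (m + 1), ?_⟩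
        rwa [Function.iterate_add_apply, Function.iterate_succ_apply', hmb, hb]
      · exact ⟨m, hmS⟩

end ParentMap

section GroundedLaplacian

variable {V R : Type*} [CommRing R]

/-- The matrix whose row `u` is `e_u` for a root `u ∈ S` and `e_u - e_{f u}` otherwise: the
Laplacian, grounded at `S`, of the directed graph that joins each vertex to its image under `f`. -/
def parentMatrix (R : Type*) [CommRing R] [DecidableEq V] (S : Finset V) (f : V → V) :
    Matrix V V R :=
  Matrix.of fun u => if u ∈ S then Pi.single u 1 else Pi.single u 1 - Pi.single (f u) 1

theorem parentMatrix_apply_of_mem [DecidableEq V] {S : Finset V} {u : V} (f : V → V)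
    (hu : u ∈ S) : parentMatrix R S f u = Pi.single u 1 :=
  if_pos hu

theorem parentMatrix_apply_of_notMem [DecidableEq V] {S : Finset V} {u : V} (f : V → V)
    (hu : u ∉ S) : parentMatrix R S f u = Pi.single u 1 - Pi.single (f u) 1 :=
  if_neg hu

theorem parentMatrix_apply_eq_one [DecidableEq V] {S : Finset V} {f : V → V} {u x : V}
    (h : u ∉ S → f u ≠ x) : parentMatrix R S f u x = (1 : Matrix V V R) u x := by
  rw [Matrix.one_eq_pi_single]
  by_cases hu : u ∈ S
  · rw [parentMatrix_apply_of_mem f hu]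
  · rw [parentMatrix_apply_of_notMem f hu, Pi.sub_apply, Pi.single_eq_of_ne (h hu).symm, sub_zero]

variable [Fintype V] [DecidableEq V] {S : Finset V} {f : V → V}

/-- Ordered by depth, the matrix is block triangular with identity blocks. -/
theorem det_parentMatrix_of_isParentMap (hf : IsParentMap S f) : (parentMatrix R S f).det = 1 := by
  obtain ⟨d, hd⟩ := hf.exists_depth
  have entry {u x : V} (h : d u ≤ d x) : parentMatrix R S f u x = (1 : Matrix V V R) u x :=
    parentMatrix_apply_eq_one fun hu hux => (hd u hu).not_ge (hux ▸ h)
  have triangular : (parentMatrix R S f).BlockTriangular (OrderDual.toDual ∘ d) :=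
    fun u x (h : d u < d x) => by
      rw [entry h.le, Matrix.one_apply_ne fun hux => h.ne (congrArg d hux)]
  rw [triangular.det]
  refine Finset.prod_eq_one fun l _ => ?_
  suffices (parentMatrix R S f).toSquareBlock (OrderDual.toDual ∘ d) l = 1 by
    rw [this, Matrix.det_one]
  ext ⟨u, rfl⟩ ⟨x, hx⟩
  rw [Matrix.toSquareBlock_def, Matrix.of_apply, entry (OrderDual.toDual.injective hx).ge]
  simp only [Matrix.one_apply, Subtype.mk.injEq]

/-- The indicator of the vertices that never reach a root is in the kernel. -/
theorem det_parentMatrix_of_forall_iterate_notMem {u : V} (hu : ∀ m, f^[m] u ∉ S) :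
    (parentMatrix R S f).det = 0 := by
  classical
  let z : V → R := fun x => if ∃ m, f^[m] x ∈ S then 0 else 1
  have z_root (x) (hx : x ∈ S) : z x = 0 := if_pos ⟨0, hx⟩
  have z_map (x) (hx : x ∉ S) : z (f x) = z x := by
    simp only [z, exists_iterate_map_iff (P := (· ∈ S)) fun h => absurd h hx]
  have kernel : (parentMatrix R S f).mulVec z = 0 := by
    ext x
    change parentMatrix R S f x ⬝ᵥ z = 0
    by_cases hx : x ∈ S
    · rw [parentMatrix_apply_of_mem f hx, single_one_dotProduct, z_root x hx]
    · rw [parentMatrix_apply_of_notMem f hx, sub_dotProduct, single_one_dotProduct,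
        single_one_dotProduct, z_map x hx, sub_self]
  have det_smul : (parentMatrix R S f).det • z = 0 := by
    rw [← Matrix.one_mulVec z, ← Matrix.smul_mulVec, ← Matrix.adjugate_mul,
      ← Matrix.mulVec_mulVec, kernel, Matrix.mulVec_zero]
  simpa [z, hu] using congrFun det_smul u

/-- The Laplacian of the directed weights `p`, grounded at `S`: row `u` is `e_u` for `u ∈ S`, and
`∑ y, p u y • (e_u - e_y)` otherwise. -/
def groundedLaplacian (S : Finset V) (p : V → V → R) : Matrix V V R :=
  Matrix.of fun u => if u ∈ S then Pi.single u 1 else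
    ∑ y, p u y • (Pi.single u 1 - Pi.single y 1)

theorem groundedLaplacian_apply_of_mem (p : V → V → R) {u : V} (hu : u ∈ S) :
    groundedLaplacian S p u = Pi.single u 1 :=
  if_pos hu

theorem groundedLaplacian_apply_of_notMem (p : V → V → R) {u : V} (hu : u ∉ S) :
    groundedLaplacian S p u = ∑ y, p u y • (Pi.single u 1 - Pi.single y 1) :=
  if_neg hu

theorem det_groundedLaplacian_eq_sum_det_parentMatrix (S : Finset V) (p : V → V → R) :
    (groundedLaplacian S p).det = ∑ f : V → V with ∀ s ∈ S, f s = s,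
      (∏ u ∈ Sᶜ, p u (f u)) * (parentMatrix R S f).det := by
  let parents : V → Finset V := fun u => if u ∈ S then {u} else Finset.univ
  let coeff : V → V → R := fun u y => if u ∈ S then 1 else p u y
  let row : V → V → V → R := fun u y =>
    if u ∈ S then Pi.single u 1 else Pi.single u 1 - Pi.single y 1
  have rows : groundedLaplacian S p = fun u => ∑ y ∈ parents u, coeff u y • row u y := by
    funext u
    by_cases hu : u ∈ S
    · rw [groundedLaplacian_apply_of_mem p hu]
      simp [parents, coeff, row, hu]
    · rw [groundedLaplacian_apply_of_notMem p hu]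
      simp [parents, coeff, row, hu]
  have prod_coeff (f : V → V) : ∏ u, coeff u (f u) = ∏ u ∈ Sᶜ, p u (f u) := by
    rw [← Finset.prod_mul_prod_compl S, Finset.prod_eq_one fun u hu => if_pos hu, one_mul]
    exact Finset.prod_congr rfl fun u hu => if_neg (Finset.mem_compl.1 hu)
  calc (groundedLaplacian S p).det
      = ∑ f ∈ Fintype.piFinset parents, Matrix.detRowAlternating.toMultilinearMap
          fun u => coeff u (f u) • row u (f u) := by
        rw [rows]
        exact MultilinearMap.map_sum_finset _ _ _
    _ = ∑ f ∈ Fintype.piFinset parents, (∏ u ∈ Sᶜ, p u (f u)) * (parentMatrix R S f).det := by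
        refine Finset.sum_congr rfl fun f _ => ?_
        rw [MultilinearMap.map_smul_univ, prod_coeff]
        rfl
    _ = _ := by
        refine Finset.sum_congr ?_ fun _ _ => rfl
        ext f
        rw [Fintype.mem_piFinset, Finset.mem_filter_univ]
        refine forall_congr' fun u => ?_
        by_cases hu : u ∈ S <;> simp [parents, hu]

open Classical in
/-- The matrix-tree theorem for directed weights: a forest directed towards its roots is given by
its parent function. -/
theorem det_groundedLaplacian (S : Finset V) (p : V → V → R) :
    (groundedLaplacian S p).det = ∑ f : V → V with IsParentMap S f, ∏ u ∈ Sᶜ, p u (f u) := by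
  rw [det_groundedLaplacian_eq_sum_det_parentMatrix, Finset.sum_filter, Finset.sum_filter]
  refine Finset.sum_congr rfl fun f _ => ?_
  by_cases hf : IsParentMap S f
  · rw [if_pos hf, if_pos hf.map_root, det_parentMatrix_of_isParentMap hf, mul_one]
  · rw [if_neg hf]
    split_ifs with hS
    · obtain ⟨u, hu⟩ : ∃ u, ∀ m, f^[m] u ∉ S := by
        by_contra! h
        exact hf ⟨hS, h⟩
      rw [det_parentMatrix_of_forall_iterate_notMem hu, mul_zero]
    · rfl

theorem updateRow_groundedLaplacian_single_self (p : V → V → R) (b : V) :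
    (groundedLaplacian S p).updateRow b (Pi.single b 1) = groundedLaplacian (insert b S) p := by
  refine funext fun u => ?_
  by_cases hu : u = b
  · subst hu
    rw [Matrix.updateRow_self, groundedLaplacian_apply_of_mem p (Finset.mem_insert_self u S)]
  · ext x
    rw [Matrix.updateRow_ne hu]
    simp only [groundedLaplacian, Matrix.of_apply, Finset.mem_insert, hu, false_or]

theorem updateRow_groundedLaplacian_single_sub (p : V → V → R) (a : V) {b : V} (hb : b ∉ S) :
    (groundedLaplacian S p).updateRow b (Pi.single b 1 - Pi.single a 1) =
      groundedLaplacian S (Function.update p b (Pi.single a 1)) := by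
  refine funext fun u => ?_
  by_cases hu : u = b
  · subst hu
    rw [Matrix.updateRow_self, groundedLaplacian_apply_of_notMem _ hb, Function.update_self,
      Finset.sum_eq_single a (fun y _ hy => by rw [Pi.single_eq_of_ne hy, zero_smul]) (by simp),
      Pi.single_eq_same, one_smul]
  · ext x
    rw [Matrix.updateRow_ne hu]
    simp only [groundedLaplacian, Matrix.of_apply, Function.update_of_ne hu]

theorem prod_compl_update_single (p : V → V → R) (a : V) {b : V} (hb : b ∉ S) (f : V → V) :
    ∏ u ∈ Sᶜ, Function.update p b (Pi.single a 1) u (f u) =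
      if f b = a then ∏ u ∈ (insert b S)ᶜ, p u (f u) else 0 := by
  have compl_eq : Sᶜ = insert b (insert b S)ᶜ := by
    rw [Finset.compl_insert, Finset.insert_erase (Finset.mem_compl.2 hb)]
  have prod_eq : ∏ u ∈ (insert b S)ᶜ, Function.update p b (Pi.single a 1) u (f u) =
      ∏ u ∈ (insert b S)ᶜ, p u (f u) :=
    Finset.prod_congr rfl fun u hu => by
      rw [Function.update_of_ne fun hub => by simp [hub] at hu]
  rw [compl_eq, Finset.prod_insert (by simp), prod_eq, Function.update_self, Pi.single_apply]
  exact ite_zero_mul _ _ _ |>.trans (by simp)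

open Classical in
theorem det_groundedLaplacian_update_single (p : V → V → R) (a : V) {b : V} (hb : b ∉ S) :
    (groundedLaplacian S (Function.update p b (Pi.single a 1))).det =
      ∑ g : V → V with IsParentMap (insert b S) g ∧ ¬ ∃ m, g^[m] a = b,
        ∏ u ∈ (insert b S)ᶜ, p u (g u) := by
  simp_rw [det_groundedLaplacian, prod_compl_update_single p a hb]
  rw [← Finset.sum_filter, Finset.filter_filter]
  have hbS : b ∈ insert b S := Finset.mem_insert_self b S
  refine Finset.sum_bij' (fun f _ => Function.update f b b) (fun g _ => Function.update g b a)
    ?_ ?_ ?_ ?_ ?_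
  · rintro f hmem
    obtain ⟨hf, rfl⟩ := (Finset.mem_filter_univ _).1 hmem
    rw [Finset.mem_filter_univ, ← isParentMap_update_iff hb (Function.update_self ..),
      Function.update_idem, Function.update_eq_self]
    exact hf
  · intro g hg
    rw [Finset.mem_filter_univ] at hg ⊢
    exact ⟨(isParentMap_update_iff hb (hg.1.map_root b hbS)).2 hg, Function.update_self ..⟩
  · rintro f hf
    obtain ⟨-, rfl⟩ := (Finset.mem_filter_univ _).1 hf
    rw [Function.update_idem, Function.update_eq_self]
  · intro g hg
    have hgb : g b = b := ((Finset.mem_filter_univ _).1 hg).1.map_root b hbS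
    conv_rhs => rw [← Function.update_eq_self b g, hgb]
    rw [Function.update_idem]
  · intro f _
    refine Finset.prod_congr rfl fun u hu => ?_
    rw [Function.update_of_ne fun hub => by simp [hub] at hu]

open Classical in
/-- The cofactor is the determinant with row `b` replaced by `e_a = e_b - (e_b - e_a)`. The row
`e_b` makes `b` a root, and the row `e_b - e_a` makes `a` the only possible parent of `b`. -/
theorem adjugate_groundedLaplacian (p : V → V → R) (a : V) {b : V} (hb : b ∉ S) :
    (groundedLaplacian S p).adjugate a b =
      ∑ f : V → V with IsParentMap (insert b S) f ∧ ∃ m, f^[m] a = b,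
        ∏ u ∈ (insert b S)ᶜ, p u (f u) := by
  have row_eq : (Pi.single a 1 : V → R) =
      Pi.single b 1 + (-1 : R) • (Pi.single b 1 - Pi.single a 1) := by
    rw [neg_one_smul, neg_sub, add_sub_cancel]
  rw [Matrix.adjugate_apply, row_eq, Matrix.det_updateRow_add, Matrix.det_updateRow_smul,
    updateRow_groundedLaplacian_single_self, updateRow_groundedLaplacian_single_sub p a hb,
    neg_one_mul, ← sub_eq_add_neg, sub_eq_iff_eq_add, det_groundedLaplacian,
    det_groundedLaplacian_update_single p a hb, ← Finset.filter_filter, ← Finset.filter_filter]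
  exact (Finset.sum_filter_add_sum_filter_not _ _ _).symm

end GroundedLaplacian

section ParentGraph

/-- The undirected graph that joins each vertex to its image under `f`. -/
def parentGraph {V : Type*} (f : V → V) : SimpleGraph V :=
  SimpleGraph.fromRel fun u x => f u = x

/-- The spanning forests of `G` in which every tree contains exactly one vertex of `S`: the vertices
of `S` are in different trees, and there are as many trees as vertices in `S`. -/
def IsRootedForest {V : Type*} (G : SimpleGraph V) (S : Finset V) (F : SimpleGraph V) : Prop :=
  IsSpanningForest G S.card F ∧ (S : Set V).Pairwise fun s t => ¬ F.Reachable s t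

open Classical in
/-- The generating function of a set of forests: the sum of their weights. -/
noncomputable def forestSum {V R : Type*} [Fintype V] [CommRing R] (w : Sym2 V → R)
    (A : Set (SimpleGraph V)) : R :=
  ∑ F : SimpleGraph V with F ∈ A, forestWeight w F

variable {V : Type*} {S : Finset V} {f g : V → V} {F G : SimpleGraph V} {a b u x : V}

theorem parentGraph_adj : (parentGraph f).Adj u x ↔ u ≠ x ∧ (f u = x ∨ f x = u) :=
  SimpleGraph.fromRel_adj _ _ _

theorem iff_of_reachable {P : V → Prop} (hP : ∀ u x, F.Adj u x → (P u ↔ P x))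
    (hab : F.Reachable a b) : P a ↔ P b := by
  obtain ⟨p⟩ := hab
  induction p with
  | nil => rfl
  | cons hadj _ ih => exact (hP _ _ hadj).trans ih

theorem reachable_parentGraph_iterate (f : V → V) (m : ℕ) (u : V) :
    (parentGraph f).Reachable u (f^[m] u) := by
  induction m with
  | zero => rfl
  | succ m ih =>
    rw [Function.iterate_succ_apply']
    refine ih.trans ?_
    by_cases h : f^[m] u = f (f^[m] u)
    · rw [← h]
    · exact (parentGraph_adj.2 ⟨h, Or.inl rfl⟩).reachable

theorem reachable_parentGraph_iff (hb : f b = b) :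
    (parentGraph f).Reachable a b ↔ ∃ m, f^[m] a = b := by
  refine ⟨fun h => ?_, fun ⟨m, hm⟩ => hm ▸ reachable_parentGraph_iterate f m a⟩
  have invariant (u) : (∃ m, f^[m] (f u) = b) ↔ ∃ m, f^[m] u = b :=
    exists_iterate_map_iff (P := (· = b)) fun hu => hu ▸ hb
  refine (iff_of_reachable (P := fun u => ∃ m, f^[m] u = b) (fun u x hux => ?_) h).2 ⟨0, rfl⟩
  obtain ⟨-, rfl | rfl⟩ := parentGraph_adj.1 hux
  · exact (invariant u).symm
  · exact invariant x

namespace IsParentMap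

theorem pairwise_not_reachable (hf : IsParentMap S f) :
    (S : Set V).Pairwise fun s t => ¬ (parentGraph f).Reachable s t := by
  intro s hs t ht hst
  rw [reachable_parentGraph_iff (hf.map_root t ht)]
  rintro ⟨m, hm⟩
  exact hst ((Function.iterate_fixed (hf.map_root s hs) m).symm.trans hm)

theorem parentGraph_adj_map (hf : IsParentMap S f) (hu : u ∉ S) : (parentGraph f).Adj u (f u) :=
  parentGraph_adj.2 ⟨(hf.map_ne hu).symm, Or.inl rfl⟩

theorem exists_eq_edge_of_adj (hf : IsParentMap S f) (h : (parentGraph f).Adj u x) :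
    ∃ y ∉ S, s(y, f y) = s(u, x) := by
  obtain ⟨hux, rfl | rfl⟩ := parentGraph_adj.1 h
  · exact ⟨u, fun hu => hux (hf.map_root u hu).symm, rfl⟩
  · exact ⟨x, fun hx => hux (hf.map_root x hx), Sym2.eq_swap⟩

theorem parentGraph_le_iff (hf : IsParentMap S f) :
    parentGraph f ≤ G ↔ ∀ u ∉ S, G.Adj u (f u) := by
  refine ⟨fun h u hu => h (hf.parentGraph_adj_map hu), fun h u x hux => ?_⟩
  obtain ⟨y, hy, hyux⟩ := hf.exists_eq_edge_of_adj hux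
  rw [← SimpleGraph.mem_edgeSet, ← hyux]
  exact h y hy

/-- Once the edge from `u` to its parent is deleted, no edge leaves the descendants of `u`. -/
theorem isAcyclic_parentGraph (hf : IsParentMap S f) : (parentGraph f).IsAcyclic := by
  rw [SimpleGraph.isAcyclic_iff_forall_adj_isBridge]
  intro v x hvx
  obtain ⟨u, hu, hedge⟩ := hf.exists_eq_edge_of_adj hvx
  rw [← hedge, SimpleGraph.isBridge_iff]
  intro hreach
  have invariant (y) (hy : y ≠ u) : (∃ m, f^[m] (f y) = u) ↔ ∃ m, f^[m] y = u :=
    exists_iterate_map_iff (P := (· = u)) fun h => absurd h hy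
  obtain ⟨m, hm⟩ : ∃ m, f^[m] (f u) = u := by
    refine (iff_of_reachable (P := fun y => ∃ m, f^[m] y = u) (fun y z hyz => ?_) hreach).1 ⟨0, rfl⟩
    obtain ⟨hadj, hne⟩ := SimpleGraph.deleteEdges_adj.1 hyz
    obtain ⟨-, rfl | rfl⟩ := parentGraph_adj.1 hadj
    · exact (invariant y fun h => hne (by simp [h])).symm
    · exact invariant z fun h => hne (by simp [h, Sym2.eq_swap])
  exact hf.iterate_map_ne hu m hm

theorem eq_of_parentGraph_eq (hf : IsParentMap S f) (hg : IsParentMap S g)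
    (h : parentGraph f = parentGraph g) : f = g := by
  funext u
  refine hf.induction (P := fun u => f u = g u) (fun s hs => ?_) (fun u hu ih => ?_) u
  · rw [hf.map_root s hs, hg.map_root s hs]
  · obtain ⟨-, hgu | hgfu⟩ := parentGraph_adj.1 (h ▸ hf.parentGraph_adj_map hu)
    · exact hgu.symm
    · exact absurd (ih.trans hgfu) (hf.iterate_map_ne hu 1)

end IsParentMap

theorem card_connectedComponent_eq_iff [Finite V]
    (hS : (S : Set V).Pairwise fun s t => ¬ F.Reachable s t) :
    Nat.card F.ConnectedComponent = S.card ↔ ∀ u, ∃ s ∈ S, F.Reachable u s := by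
  let component : S → F.ConnectedComponent := fun s => F.connectedComponentMk s
  have injective : Function.Injective component := fun s t hst =>
    Subtype.ext (hS.eq s.2 t.2 (not_not.2 (SimpleGraph.ConnectedComponent.exact hst)))
  have surjective_iff : Function.Surjective component ↔ ∀ u, ∃ s ∈ S, F.Reachable u s := by
    simp only [Function.Surjective, SimpleGraph.ConnectedComponent.forall, Subtype.exists,
      exists_prop, component, SimpleGraph.ConnectedComponent.eq, SimpleGraph.reachable_comm]
  rw [← surjective_iff, ← Nat.card_eq_finsetCard]
  refine ⟨fun h => ?_, fun h => (Nat.card_eq_of_bijective component ⟨injective, h⟩).symm⟩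
  exact ((Nat.bijective_iff_injective_and_card component).2 ⟨injective, h.symm⟩).2

theorem isRootedForest_iff [Finite V] :
    IsRootedForest G S F ↔ F ≤ G ∧ F.IsAcyclic ∧
      (S : Set V).Pairwise (fun s t => ¬ F.Reachable s t) ∧ ∀ u, ∃ s ∈ S, F.Reachable u s := by
  rw [IsRootedForest, IsSpanningForest, and_assoc, and_assoc]
  refine and_congr_right fun _ => and_congr_right fun _ => ?_
  rw [and_comm]
  exact and_congr_right fun hS => card_connectedComponent_eq_iff hS

theorem isRootedForest_parentGraph [Finite V] (hf : IsParentMap S f) (hG : parentGraph f ≤ G) :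
    IsRootedForest G S (parentGraph f) := by
  refine isRootedForest_iff.2 ⟨hG, hf.isAcyclic_parentGraph, hf.pairwise_not_reachable, fun u => ?_⟩
  obtain ⟨m, hm⟩ := hf.exists_iterate_mem u
  exact ⟨_, hm, reachable_parentGraph_iterate f m u⟩

theorem exists_adj_dist_lt (h : F.Reachable a b) (hab : a ≠ b) :
    ∃ x, F.Adj a x ∧ F.Reachable x b ∧ F.dist x b < F.dist a b := by
  obtain ⟨p, hp⟩ := h.exists_walk_length_eq_dist
  obtain ⟨x, hax, q, rfl⟩ := SimpleGraph.Walk.exists_eq_cons_of_ne hab p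
  rw [SimpleGraph.Walk.length_cons] at hp
  exact ⟨x, hax, ⟨q⟩, hp ▸ Nat.lt_succ_of_le (SimpleGraph.dist_le q)⟩

/-- The parent of a vertex is a neighbour that is closer to the root. -/
theorem exists_isParentMap_parentGraph_le
    (hS : (S : Set V).Pairwise fun s t => ¬ F.Reachable s t)
    (hF : ∀ u, ∃ s ∈ S, F.Reachable u s) : ∃ f, IsParentMap S f ∧ parentGraph f ≤ F := by
  classical
  choose r hrS hr using hF
  have root_eq {u s : V} (hs : s ∈ S) (h : F.Reachable u s) : r u = s :=
    hS.eq (hrS u) hs (not_not.2 ((hr u).symm.trans h))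
  have exists_parent : ∀ u, ∃ y, u ∉ S → F.Adj u y ∧ F.dist y (r y) < F.dist u (r u) := by
    intro u
    by_cases hu : u ∈ S
    · exact ⟨u, absurd hu⟩
    · obtain ⟨y, huy, hy, hlt⟩ := exists_adj_dist_lt (hr u) fun h => hu (h ▸ hrS u)
      exact ⟨y, fun _ => ⟨huy, by rwa [root_eq (hrS u) hy]⟩⟩
  choose y hy using exists_parent
  have parent_of_notMem (u) (hu : u ∉ S) : (if u ∈ S then u else y u) = y u := if_neg hu
  have isParentMap : IsParentMap S fun u => if u ∈ S then u else y u :=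
    .of_depth (fun s hs => if_pos hs) (fun u => F.dist u (r u)) fun u hu => by
      rw [parent_of_notMem u hu]
      exact (hy u hu).2
  refine ⟨_, isParentMap, isParentMap.parentGraph_le_iff.2 fun u hu => ?_⟩
  rw [parent_of_notMem u hu]
  exact (hy u hu).1

theorem reachable_eq_of_le {H : SimpleGraph V} (hHF : H ≤ F)
    (hF : (S : Set V).Pairwise fun s t => ¬ F.Reachable s t)
    (hH : ∀ u, ∃ s ∈ S, H.Reachable u s) : H.Reachable = F.Reachable := by
  ext u x
  refine ⟨SimpleGraph.Reachable.mono hHF, fun h => ?_⟩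
  obtain ⟨s, hs, hus⟩ := hH u
  obtain ⟨t, ht, hxt⟩ := hH x
  obtain rfl : s = t :=
    hF.eq hs ht (not_not.2 ((hus.mono hHF).symm.trans (h.trans (hxt.mono hHF))))
  exact hus.trans hxt.symm

theorem exists_parentGraph_eq [Finite V] (hF : IsRootedForest G S F) :
    ∃ f, IsParentMap S f ∧ parentGraph f = F := by
  obtain ⟨-, hacyclic, hS, hroot⟩ := isRootedForest_iff.1 hF
  obtain ⟨f, hf, hle⟩ := exists_isParentMap_parentGraph_le hS hroot
  have hreach : (parentGraph f).Reachable = F.Reachable := reachable_eq_of_le hle hS fun u =>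
    let ⟨m, hm⟩ := hf.exists_iterate_mem u
    ⟨_, hm, reachable_parentGraph_iterate f m u⟩
  have hmax :=
    (SimpleGraph.maximal_isAcyclic_iff_reachable_eq hle hf.isAcyclic_parentGraph).2 hreach
  exact ⟨f, hf, hle.antisymm (hmax.2 ⟨le_rfl, hacyclic⟩ hle)⟩

theorem edgeWeight_of_adj {R : Type*} [Zero R] (w : Sym2 V → R) (h : G.Adj u x) :
    edgeWeight G w u x = w s(u, x) :=
  if_pos h

theorem edgeWeight_of_not_adj {R : Type*} [Zero R] (w : Sym2 V → R) (h : ¬ G.Adj u x) :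
    edgeWeight G w u x = 0 :=
  if_neg h

theorem edgeWeight_comm {R : Type*} [Zero R] (G : SimpleGraph V) (w : Sym2 V → R) (u x : V) :
    edgeWeight G w u x = edgeWeight G w x u := by
  rw [edgeWeight, edgeWeight, G.adj_comm, Sym2.eq_swap]

variable {R : Type*} [CommRing R] [Fintype V]

theorem sum_eq_forestSum_of_bijOn {α : Type*} {s : Finset α} {A : Set (SimpleGraph V)} {c : α → R}
    {w : Sym2 V → R} {φ : α → SimpleGraph V} (hφ : Set.BijOn φ s A)
    (hc : ∀ x ∈ s, c x = forestWeight w (φ x)) : ∑ x ∈ s, c x = forestSum w A := by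
  classical
  refine Finset.sum_bij (fun x _ => φ x) (fun x hx => ?_) (fun x hx y hy => hφ.injOn hx hy)
    (fun F hF => ?_) hc
  · exact (Finset.mem_filter_univ _).2 (hφ.mapsTo hx)
  · obtain ⟨x, hx, hxF⟩ := hφ.surjOn ((Finset.mem_filter_univ _).1 hF)
    exact ⟨x, hx, hxF⟩

variable [DecidableEq V]

theorem prod_edgeWeight_eq_forestWeight (w : Sym2 V → R) (hf : IsParentMap S f)
    (hG : parentGraph f ≤ G) :
    ∏ u ∈ Sᶜ, edgeWeight G w u (f u) = forestWeight w (parentGraph f) := by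
  classical
  have injOn : Set.InjOn (fun u => s(u, f u)) (Sᶜ : Finset V) := fun u _ x hx h => by
    obtain ⟨hux, -⟩ | ⟨hufx, hfux⟩ := Sym2.eq_iff.1 h
    · exact hux
    · exact absurd (hufx ▸ hfux) (hf.iterate_map_ne (Finset.mem_compl.1 hx) 1)
  have image_eq : Sᶜ.image (fun u => s(u, f u)) = (parentGraph f).edgeFinset := by
    ext e
    induction e with | h u x =>
    rw [SimpleGraph.mem_edgeFinset, SimpleGraph.mem_edgeSet, Finset.mem_image]
    simp only [Finset.mem_compl]
    refine ⟨?_, hf.exists_eq_edge_of_adj⟩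
    rintro ⟨y, hy, h⟩
    rw [← SimpleGraph.mem_edgeSet, ← h]
    exact hf.parentGraph_adj_map hy
  calc ∏ u ∈ Sᶜ, edgeWeight G w u (f u)
      = ∏ u ∈ Sᶜ, w s(u, f u) := Finset.prod_congr rfl fun u hu =>
        edgeWeight_of_adj w (hG (hf.parentGraph_adj_map (Finset.mem_compl.1 hu)))
    _ = ∏ e ∈ (parentGraph f).edgeFinset, w e := by rw [← image_eq, Finset.prod_image injOn]
    _ = forestWeight w (parentGraph f) := by rw [forestWeight]

open Classical in
theorem sum_isParentMap_eq_forestSum (G : SimpleGraph V) (w : Sym2 V → R) (S : Finset V)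
    (P : SimpleGraph V → Prop) :
    ∑ f : V → V with IsParentMap S f ∧ P (parentGraph f), ∏ u ∈ Sᶜ, edgeWeight G w u (f u) =
      forestSum w {F | IsRootedForest G S F ∧ P F} := by
  have le_of_prod_ne_zero {f : V → V} (hf : IsParentMap S f)
      (hprod : ∏ u ∈ Sᶜ, edgeWeight G w u (f u) ≠ 0) : parentGraph f ≤ G :=
    hf.parentGraph_le_iff.2 fun u hu => by_contra fun hadj => hprod <|
      Finset.prod_eq_zero (Finset.mem_compl.2 hu) (edgeWeight_of_not_adj w hadj)
  rw [← Finset.sum_filter_of_ne (p := fun f : V → V => parentGraph f ≤ G)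
    fun f hf => le_of_prod_ne_zero ((Finset.mem_filter_univ f).1 hf).1, Finset.filter_filter]
  refine sum_eq_forestSum_of_bijOn (φ := parentGraph) ⟨?_, ?_, ?_⟩ ?_
  · intro f hf
    obtain ⟨⟨hf, hP⟩, hG⟩ := (Finset.mem_filter_univ f).1 hf
    exact ⟨isRootedForest_parentGraph hf hG, hP⟩
  · intro f hf g hg
    exact ((Finset.mem_filter_univ f).1 hf).1.1.eq_of_parentGraph_eq
      ((Finset.mem_filter_univ g).1 hg).1.1
  · rintro F ⟨hF, hP⟩
    obtain ⟨f, hf, rfl⟩ := exists_parentGraph_eq hF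
    exact ⟨f, (Finset.mem_filter_univ f).2 ⟨⟨hf, hP⟩, hF.1.1⟩, rfl⟩
  · intro f hf
    obtain ⟨⟨hf, -⟩, hG⟩ := (Finset.mem_filter_univ f).1 hf
    exact prod_edgeWeight_eq_forestWeight w hf hG

end ParentGraph

section LaplacianMinors

variable {V ι R : Type*} [Fintype V] [DecidableEq V] [CommRing R] {S : Finset V} {t : ι → V}

theorem groundedLaplacian_edgeWeight_apply {u : V} (G : SimpleGraph V)
    (w : Sym2 V → R) (hu : u ∉ S) :
    groundedLaplacian S (edgeWeight G w) u = weightedLaplacian G w u := by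
  rw [groundedLaplacian_apply_of_notMem _ hu]
  ext x
  simp only [Finset.sum_apply, Pi.smul_apply, Pi.sub_apply, smul_eq_mul, weightedLaplacian,
    Matrix.of_apply]
  split_ifs with hux
  · subst hux
    rw [← Finset.add_sum_erase _ _ (Finset.mem_univ u), sub_self, mul_zero, zero_add]
    refine Finset.sum_congr rfl fun y hy => ?_
    rw [Pi.single_eq_same, Pi.single_eq_of_ne (Finset.ne_of_mem_erase hy).symm, sub_zero, mul_one]
  · have single_eq (y) :
        (Pi.single u 1 : V → R) x - (Pi.single y 1 : V → R) x = if x = y then -1 else 0 := by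
      rw [Pi.single_eq_of_ne (Ne.symm hux), Pi.single_apply, zero_sub, apply_ite Neg.neg, neg_zero]
    simp only [single_eq, mul_ite, mul_zero, mul_neg_one,
      Finset.sum_ite_eq, Finset.mem_univ, if_true]

theorem isSymm_weightedLaplacian (G : SimpleGraph V) (w : Sym2 V → R) :
    (weightedLaplacian G w).IsSymm := by
  refine Matrix.IsSymm.ext fun u x => ?_
  obtain rfl | hux := eq_or_ne u x
  · rfl
  · simp only [weightedLaplacian, Matrix.of_apply, if_neg hux, if_neg hux.symm,
      edgeWeight_comm G w x u]

theorem submatrix_weightedLaplacian (G : SimpleGraph V) (w : Sym2 V → R)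
    (hS : Set.range t = (S : Set V)ᶜ) :
    (weightedLaplacian G w).submatrix t t =
      (groundedLaplacian S (edgeWeight G w)).submatrix t t := by
  ext x y
  have hx : t x ∉ S := hS.le (Set.mem_range_self x)
  rw [Matrix.submatrix_apply, Matrix.submatrix_apply, groundedLaplacian_edgeWeight_apply G w hx]

theorem groundedLaplacian_apply_of_notMem_range (p : V → V → R)
    (hS : Set.range t = (S : Set V)ᶜ) (u) (hu : u ∉ Set.range t) :
    groundedLaplacian S p u = Pi.single u 1 :=
  groundedLaplacian_apply_of_mem p (by simpa [hS] using hu)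

variable [Fintype ι] [DecidableEq ι]

theorem det_submatrix_of_unit_rows (A : Matrix V V R) (ht : Function.Injective t)
    (hA : ∀ u ∉ Set.range t, A u = Pi.single u 1) : (A.submatrix t t).det = A.det := by
  classical
  have triangular : ∀ u, u ∉ Set.range t → ∀ x, x ∈ Set.range t → A u x = 0 := fun u hu x hx => by
    rw [hA u hu, Pi.single_eq_of_ne (ne_of_mem_of_not_mem hx hu)]
  have unit_block : (A.toSquareBlockProp fun u => u ∉ Set.range t) = 1 := by
    ext u x
    rw [Matrix.toSquareBlockProp_def, Matrix.of_apply, hA u u.2, Matrix.one_apply,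
      Pi.single_apply]
    simp only [Subtype.ext_iff, eq_comm]
  rw [Matrix.twoBlockTriangular_det A (· ∈ Set.range t) triangular, unit_block, Matrix.det_one,
    mul_one]
  convert Matrix.det_submatrix_equiv_self (Equiv.ofInjective t ht)
    (A.toSquareBlockProp (· ∈ Set.range t))
  rfl

theorem adjugate_submatrix_of_unit_rows (A : Matrix V V R) (ht : Function.Injective t)
    (hA : ∀ u ∉ Set.range t, A u = Pi.single u 1) (a b : ι) :
    (A.submatrix t t).adjugate a b = A.adjugate (t a) (t b) := by
  have update_eq : (A.submatrix t t).updateRow b (Pi.single a 1) =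
      (A.updateRow (t b) (Pi.single (t a) 1)).submatrix t t := by
    ext x y
    by_cases hx : x = b
    · subst hx
      simp only [Matrix.submatrix_apply, Matrix.updateRow_self, Pi.single_apply, ht.eq_iff]
    · simp only [Matrix.submatrix_apply, Matrix.updateRow_ne hx, Matrix.updateRow_ne (ht.ne hx)]
  rw [Matrix.adjugate_apply, Matrix.adjugate_apply, update_eq]
  refine det_submatrix_of_unit_rows _ ht fun u hu => ?_
  ext x
  rw [Matrix.updateRow_ne fun h => hu ⟨b, h.symm⟩, hA u hu]

/-- The all-minors matrix-tree theorem, for principal minors. -/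
theorem det_submatrix_weightedLaplacian (G : SimpleGraph V) (w : Sym2 V → R)
    (ht : Function.Injective t) (hS : Set.range t = (S : Set V)ᶜ) :
    ((weightedLaplacian G w).submatrix t t).det = forestSum w {F | IsRootedForest G S F} := by
  classical
  rw [submatrix_weightedLaplacian G w hS,
    det_submatrix_of_unit_rows _ ht (groundedLaplacian_apply_of_notMem_range _ hS),
    det_groundedLaplacian]
  simpa only [and_true] using sum_isParentMap_eq_forestSum G w S fun _ => True

/-- The all-minors matrix-tree theorem, for minors whose sets of removed rows and columns differ in
one element. -/
theorem adjugate_submatrix_weightedLaplacian (G : SimpleGraph V) (w : Sym2 V → R)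
    (ht : Function.Injective t) (hS : Set.range t = (S : Set V)ᶜ) (a b : ι) :
    ((weightedLaplacian G w).submatrix t t).adjugate a b =
      forestSum w {F | IsRootedForest G (insert (t a) S) F ∧ F.Reachable (t a) (t b)} := by
  classical
  have ha : t a ∉ S := hS.le (Set.mem_range_self a)
  rw [← ((isSymm_weightedLaplacian G w).submatrix t).adjugate.apply,
    submatrix_weightedLaplacian G w hS,
    adjugate_submatrix_of_unit_rows _ ht (groundedLaplacian_apply_of_notMem_range _ hS),
    adjugate_groundedLaplacian _ _ ha,
    ← sum_isParentMap_eq_forestSum G w _ fun F => F.Reachable (t a) (t b)]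
  refine Finset.sum_congr (Finset.ext fun f => ?_) fun _ _ => rfl
  simp only [Finset.mem_filter_univ]
  refine and_congr_right fun hf => ?_
  rw [SimpleGraph.reachable_comm,
    reachable_parentGraph_iff (hf.map_root _ (Finset.mem_insert_self _ _))]

end LaplacianMinors

section VecCons

variable {α R : Type*} [CommRing R] {m : ℕ} {t : Fin m → α} {S : Finset α} {b : α}

theorem range_vecCons_eq_compl_erase [DecidableEq α] (ht : Set.range t = (S : Set α)ᶜ) (b : α) :
    Set.range (Matrix.vecCons b t) = (S.erase b : Set α)ᶜ := by
  rw [Matrix.range_cons, ht, Finset.coe_erase, Set.compl_sdiff]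

theorem vecCons_injective_of_range_eq_compl (ht : Function.Injective t)
    (hS : Set.range t = (S : Set α)ᶜ) (hb : b ∈ S) : Function.Injective (Matrix.vecCons b t) :=
  Fin.cons_injective_iff.2 ⟨fun h => hS.le h hb, ht⟩

theorem det_submatrix_vecCons (A : Matrix α α R) (a b : α) (t : Fin m → α) :
    (A.submatrix (Matrix.vecCons a t) (Matrix.vecCons b t)).det =
      -(A.submatrix (Matrix.vecCons a (Matrix.vecCons b t))
        (Matrix.vecCons a (Matrix.vecCons b t))).adjugate 0 1 := by
  have vecCons_one_succAbove :
      Matrix.vecCons a (Matrix.vecCons b t) ∘ (1 : Fin (m + 2)).succAbove = Matrix.vecCons a t := by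
    funext x
    cases x using Fin.cases with
    | zero => rfl
    | succ x =>
      rw [Function.comp_apply, ← Fin.succ_zero_eq_one, Fin.succ_succAbove_succ,
        Fin.succAbove_zero, Matrix.cons_val_succ, Matrix.cons_val_succ, Matrix.cons_val_succ]
  rw [Matrix.adjugate_fin_succ_eq_det_submatrix, Matrix.submatrix_submatrix, vecCons_one_succAbove,
    Fin.val_one, Fin.val_zero, add_zero, pow_one, neg_one_mul, neg_neg]
  rfl

/-- Expanding the second factor along its first row turns the sum into entries of
`M.adjugate * M = M.det • 1`. -/
theorem sum_adjugate_mul_det_submatrix_vecCons [Fintype α] [DecidableEq α] (M : Matrix α α R)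
    (s : Fin m → α) (hb : b ∉ Set.range t) :
    ∑ a, M.adjugate b a * (M.submatrix (Matrix.vecCons a s) (Matrix.vecCons b t)).det =
      M.det * (M.submatrix s t).det := by
  let cofactor (l : Fin (m + 1)) : R :=
    (-1) ^ (l : ℕ) * (M.submatrix s (Matrix.vecCons b t ∘ l.succAbove)).det
  have expansion (a) : (M.submatrix (Matrix.vecCons a s) (Matrix.vecCons b t)).det =
      ∑ l, M a (Matrix.vecCons b t l) * cofactor l := by
    rw [Matrix.det_succ_row_zero]
    refine Finset.sum_congr rfl fun l _ => ?_
    rw [Matrix.submatrix_submatrix, mul_assoc, mul_left_comm]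
    rfl
  have sum_adjugate (l) :
      ∑ a, M.adjugate b a * M a (Matrix.vecCons b t l) = if l = 0 then M.det else 0 := by
    rw [← Matrix.mul_apply, Matrix.adjugate_mul, Matrix.smul_apply, Matrix.one_apply, smul_eq_mul,
      mul_ite, mul_one, mul_zero]
    refine if_congr ?_ rfl rfl
    cases l using Fin.cases with
    | zero => exact iff_of_true rfl rfl
    | succ x => exact iff_of_false (fun h => hb ⟨x, h.symm⟩) (Fin.succ_ne_zero x)
  calc ∑ a, M.adjugate b a * (M.submatrix (Matrix.vecCons a s) (Matrix.vecCons b t)).det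
      = ∑ l, (∑ a, M.adjugate b a * M a (Matrix.vecCons b t l)) * cofactor l := by
        simp only [expansion, Finset.mul_sum, Finset.sum_mul, mul_assoc]
        rw [Finset.sum_comm]
    _ = M.det * cofactor 0 := by
        simp only [sum_adjugate, ite_mul, zero_mul, Finset.sum_ite_eq', Finset.mem_univ, if_true]
    _ = M.det * (M.submatrix s t).det := by
        simp only [cofactor, Fin.val_zero, pow_zero, one_mul]
        rfl

variable [Fintype α] [DecidableEq α]

theorem det_submatrix_vecCons_self_weightedLaplacian (G : SimpleGraph α) (w : Sym2 α → R)
    (ht : Function.Injective t) (hS : Set.range t = (S : Set α)ᶜ) (hb : b ∈ S) :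
    ((weightedLaplacian G w).submatrix (Matrix.vecCons b t) (Matrix.vecCons b t)).det =
      forestSum w {F | IsRootedForest G (S.erase b) F} :=
  det_submatrix_weightedLaplacian G w (vecCons_injective_of_range_eq_compl ht hS hb)
    (range_vecCons_eq_compl_erase hS b)

theorem det_submatrix_vecCons_weightedLaplacian_of_ne {a : α} (G : SimpleGraph α)
    (w : Sym2 α → R) (ht : Function.Injective t) (hS : Set.range t = (S : Set α)ᶜ)
    (ha : a ∈ S) (hb : b ∈ S) (hab : a ≠ b) :
    ((weightedLaplacian G w).submatrix (Matrix.vecCons a t) (Matrix.vecCons b t)).det =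
      -forestSum w {F | IsRootedForest G (S.erase b) F ∧ F.Reachable b a} := by
  have ha' : a ∈ S.erase b := Finset.mem_erase_of_ne_of_mem hab ha
  have hinj := vecCons_injective_of_range_eq_compl ht hS hb
  have hrange := range_vecCons_eq_compl_erase hS b
  rw [det_submatrix_vecCons, adjugate_submatrix_weightedLaplacian G w
    (vecCons_injective_of_range_eq_compl hinj hrange ha') (range_vecCons_eq_compl_erase hrange a)]
  simp only [Matrix.cons_val_zero, Matrix.cons_val_one, Finset.insert_erase ha',
    SimpleGraph.reachable_comm (u := b)]

end VecCons

section ColumnExpansion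

variable {R : Type*} [CommRing R] {k n : ℕ}

/-- The increasing enumeration of the indices that are not in `[k]`. -/
def tailIdx (h : k ≤ n) : Fin (firstIdx h)ᶜ.card ↪o Fin n :=
  (firstIdx h)ᶜ.orderEmbOfFin rfl

theorem castLE_mem_firstIdx (h : k ≤ n) (i : Fin k) : Fin.castLE h i ∈ firstIdx h :=
  Finset.mem_map_of_mem _ (Finset.mem_univ i)

theorem range_tailIdx (h : k ≤ n) : Set.range (tailIdx h) = (firstIdx h : Set (Fin n))ᶜ := by
  rw [tailIdx, Finset.range_orderEmbOfFin, Finset.coe_compl]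

theorem tailIdx_notMem_firstIdx (h : k ≤ n) (x) : tailIdx h x ∉ firstIdx h :=
  (range_tailIdx h).le (Set.mem_range_self x)

theorem le_of_notMem_firstIdx {h : k ≤ n} {x : Fin n} (hx : x ∉ firstIdx h) : k ≤ x :=
  not_lt.1 fun hlt => hx (castLE_mem_firstIdx h ⟨x, hlt⟩)

theorem strictMono_vecCons_tailIdx (h : k ≤ n) (i : Fin k) :
    StrictMono (Matrix.vecCons (Fin.castLE h i) (tailIdx h)) := by
  intro x y hxy
  obtain ⟨y, rfl⟩ := Fin.exists_succ_eq_of_ne_zero (Fin.ne_zero_of_lt hxy)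
  cases x using Fin.cases with
  | zero => exact i.2.trans_le (le_of_notMem_firstIdx (tailIdx_notMem_firstIdx h y))
  | succ x => exact (tailIdx h).strictMono (Fin.succ_lt_succ_iff.1 hxy)

theorem det_removeRowsCols {m : ℕ} (M : Matrix (Fin n) (Fin n) R)
    {U W : Finset (Fin n)} (h : W.card = U.card) {f g : Fin m → Fin n} (hf : StrictMono f)
    (hg : StrictMono g) (hfU : ∀ x, f x ∉ U) (hgW : ∀ x, g x ∉ W) (hm : Uᶜ.card = m) :
    (removeRowsCols M U W h).det = (M.submatrix f g).det := by
  subst hm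
  rw [removeRowsCols,
    Finset.orderEmbOfFin_unique rfl (fun x => Finset.mem_compl.2 (hfU x)) hf,
    Finset.orderEmbOfFin_unique _ (fun x => Finset.mem_compl.2 (hgW x)) hg]

theorem adjugate_eq_det_removeRowsCols (M : Matrix (Fin n) (Fin n) R) (i j : Fin n) :
    M.adjugate j i = (-1) ^ ((i : ℕ) + (j : ℕ)) * (removeRowsCols M {i} {j} rfl).det := by
  obtain _ | n := n
  · exact i.elim0
  · have succAbove_notMem (i : Fin (n + 1)) (x) : i.succAbove x ∉ ({i} : Finset (Fin (n + 1))) :=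
      Finset.notMem_singleton.2 (Fin.succAbove_ne i x)
    rw [Matrix.adjugate_fin_succ_eq_det_submatrix,
      det_removeRowsCols M (U := {i}) (W := {j}) rfl (Fin.strictMono_succAbove i)
        (Fin.strictMono_succAbove j) (succAbove_notMem i) (succAbove_notMem j)
        (by rw [Finset.card_compl, Fintype.card_fin, Finset.card_singleton, Nat.add_sub_cancel])]

theorem det_removeRowsCols_erase_firstIdx (h : k ≤ n) (M : Matrix (Fin n) (Fin n) R)
    (i j : Fin k) :
    (removeRowsCols M ((firstIdx h).erase (Fin.castLE h i)) ((firstIdx h).erase (Fin.castLE h j))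
      (card_erase_firstIdx h i j)).det =
      (M.submatrix (Matrix.vecCons (Fin.castLE h i) (tailIdx h))
        (Matrix.vecCons (Fin.castLE h j) (tailIdx h))).det := by
  have vecCons_notMem (i : Fin k) (x) : Matrix.vecCons (Fin.castLE h i) (tailIdx h) x ∉
      (firstIdx h).erase (Fin.castLE h i) := by
    cases x using Fin.cases with
    | zero => exact Finset.notMem_erase _ _
    | succ x => exact fun hx => tailIdx_notMem_firstIdx h x (Finset.mem_of_mem_erase hx)
  refine det_removeRowsCols M _ (strictMono_vecCons_tailIdx h i) (strictMono_vecCons_tailIdx h j)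
    (vecCons_notMem i) (vecCons_notMem j) ?_
  rw [Finset.compl_erase, Finset.card_insert_of_notMem]
  exact Finset.notMem_compl.2 (castLE_mem_firstIdx h i)

theorem columnExpansionRight_eq_sum_adjugate (h : k ≤ n) (M : Matrix (Fin n) (Fin n) R)
    (j : Fin k) :
    columnExpansionRight h M j = ∑ i : Fin k, M.adjugate (Fin.castLE h j) (Fin.castLE h i) *
      (M.submatrix (Matrix.vecCons (Fin.castLE h i) (tailIdx h))
        (Matrix.vecCons (Fin.castLE h j) (tailIdx h))).det := by
  refine Finset.sum_congr rfl fun i _ => ?_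
  rw [det_removeRowsCols_erase_firstIdx, adjugate_eq_det_removeRowsCols]
  rfl

theorem columnExpansionLeft_eq_columnExpansionRight (h : k ≤ n) (M : Matrix (Fin n) (Fin n) R)
    (j : Fin k) : columnExpansionLeft h M = columnExpansionRight h M j := by
  let minor (i : Fin n) : R := (M.submatrix (Matrix.vecCons i (tailIdx h))
    (Matrix.vecCons (Fin.castLE h j) (tailIdx h))).det
  have castLE_notMem : Fin.castLE h j ∉ Set.range (tailIdx h) := by
    rw [range_tailIdx]
    exact not_not.2 (castLE_mem_firstIdx h j)
  have repeated_row (i) (hi : i ∉ firstIdx h) : minor i = 0 := by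
    obtain ⟨x, rfl⟩ := (range_tailIdx h).ge hi
    exact Matrix.det_zero_of_row_eq (Fin.succ_ne_zero x).symm rfl
  calc columnExpansionLeft h M
      = ∑ i, M.adjugate (Fin.castLE h j) i * minor i :=
        (sum_adjugate_mul_det_submatrix_vecCons M _ castLE_notMem).symm
    _ = ∑ i ∈ firstIdx h, M.adjugate (Fin.castLE h j) i * minor i := by
        refine (Finset.sum_subset (Finset.subset_univ _) fun i _ hi => ?_).symm
        rw [repeated_row i hi, mul_zero]
    _ = columnExpansionRight h M j := by
        rw [columnExpansionRight_eq_sum_adjugate]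
        exact Finset.sum_map Finset.univ (Fin.castLEEmb h) _

end ColumnExpansion

section Pairs

variable {V ι R : Type*} [Fintype V] [CommRing R] (w : Sym2 V → R)

theorem forestSum_mul_forestSum (A B : Set (SimpleGraph V)) :
    forestSum w A * forestSum w B = pairSum w (A ×ˢ B) := by
  classical
  rw [forestSum, forestSum, pairSum, Finset.sum_mul_sum, ← Finset.sum_product',
    ← Finset.filter_product, Finset.univ_product_univ]
  simp only [Set.mem_prod]

theorem pairSum_sdiff_biUnion (A : Set (SimpleGraph V × SimpleGraph V)) (I : Finset ι)
    {B : ι → Set (SimpleGraph V × SimpleGraph V)} (hBA : ∀ i ∈ I, B i ⊆ A)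
    (hB : (I : Set ι).PairwiseDisjoint B) :
    pairSum w (A \ ⋃ i ∈ I, B i) = pairSum w A - ∑ i ∈ I, pairSum w (B i) := by
  classical
  have pairSum_eq (A : Set (SimpleGraph V × SimpleGraph V)) :
      pairSum w A = ∑ p, A.indicator (fun p => forestWeight w p.1 * forestWeight w p.2) p := by
    rw [pairSum, Finset.sum_filter]
    exact Finset.sum_congr rfl fun p _ =>
      (Set.indicator_apply A (fun p => forestWeight w p.1 * forestWeight w p.2) p).symm
  simp only [pairSum_eq]
  rw [Finset.sum_comm, ← Finset.sum_sub_distrib]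
  refine Finset.sum_congr rfl fun p _ => ?_
  rw [Set.indicator_sdiff (Set.iUnion₂_subset hBA), Pi.sub_apply, Finset.indicator_biUnion I B hB]

end Pairs

section SharingPairs

/-- The pairs of a forest of two trees, rooted at `c` and `j`, and a forest rooted at the vertices
of `S` other than `j`, such that `a` and `j` are in the same tree of both forests. With `a = j` the
last condition is void. -/
def sharingPairs {V : Type*} [DecidableEq V] (G : SimpleGraph V) (S : Finset V) (c j a : V) :
    Set (SimpleGraph V × SimpleGraph V) :=
  {F | IsRootedForest G {j, c} F ∧ F.Reachable j a} ×ˢ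
    {F | IsRootedForest G (S.erase j) F ∧ F.Reachable j a}

variable {V ι : Type*} [DecidableEq V] {G F : SimpleGraph V} {S : Finset V} {c j a b : V}
  {v : ι → V}

theorem sharingPairs_subset_self : sharingPairs G S c j a ⊆ sharingPairs G S c j j :=
  fun _ hp => ⟨⟨hp.1.1, .refl _⟩, ⟨hp.2.1, .refl _⟩⟩

theorem disjoint_sharingPairs (ha : a ∈ S.erase j) (hb : b ∈ S.erase j) (hab : a ≠ b) :
    Disjoint (sharingPairs G S c j a) (sharingPairs G S c j b) :=
  Set.disjoint_left.2 fun _ hpa hpb => hpa.2.1.2 ha hb hab (hpa.2.2.symm.trans hpb.2.2)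

theorem isRootedForest_image {I : Finset ι} (hv : Function.Injective v) :
    IsRootedForest G (I.image v) F ↔ IsSpanningForest G I.card F ∧
      (I : Set ι).Pairwise fun a b => ¬ F.Reachable (v a) (v b) := by
  rw [IsRootedForest, Finset.card_image_of_injective _ hv, Finset.coe_image,
    hv.injOn.pairwise_image]

theorem isRootedForest_pair (hjc : j ≠ c) :
    IsRootedForest G {j, c} F ↔ IsSpanningForest G 2 F ∧ ¬ F.Reachable c j := by
  rw [IsRootedForest, Finset.card_pair hjc, Finset.coe_pair, Set.pairwise_pair,
    SimpleGraph.reachable_comm, and_self, forall_prop_of_true hjc]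

variable {k : ℕ} {v : Fin (k + 1) → V}

theorem leftPairs_eq_prod (hv : Function.Injective v) (c : V) :
    leftPairs G v =
      {F | IsRootedForest G {c} F} ×ˢ {F | IsRootedForest G (Finset.univ.image v) F} := by
  ext p
  rw [Set.mem_prod, Set.mem_ofPred_eq, Set.mem_ofPred_eq, isRootedForest_image hv, IsRootedForest,
    Finset.card_singleton, Finset.coe_singleton, and_iff_left (Set.pairwise_singleton _ _),
    Finset.card_univ, Fintype.card_fin, Finset.coe_univ, Set.pairwise_univ]
  rfl

theorem mem_sharingPairs_self_iff (hv : Function.Injective v) {c j : Fin (k + 1)} (hjc : j ≠ c)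
    {p : SimpleGraph V × SimpleGraph V} :
    p ∈ sharingPairs G (Finset.univ.image v) (v c) (v j) (v j) ↔
      IsSpanningForest G 2 p.1 ∧ IsSpanningForest G k p.2 ∧ ¬ p.1.Reachable (v c) (v j) ∧
        ∀ a b, a ≠ j → b ≠ j → a ≠ b → ¬ p.2.Reachable (v a) (v b) := by
  have card_erase : (Finset.univ.erase j).card = k := by
    rw [Finset.card_erase_of_mem (Finset.mem_univ j), Finset.card_univ, Fintype.card_fin,
      Nat.add_sub_cancel]
  rw [sharingPairs, Set.mem_prod, Set.mem_ofPred_eq, Set.mem_ofPred_eq,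
    isRootedForest_pair (hv.ne hjc), ← Finset.image_erase hv, isRootedForest_image hv, card_erase]
  simp only [Set.Pairwise, Finset.coe_erase, Finset.coe_univ, Set.mem_sdiff, Set.mem_univ, true_and,
    Set.mem_singleton_iff, SimpleGraph.Reachable.refl, and_true]
  grind

/-- Since the marked vertices other than `j` are in different trees of the second forest and `c` and
`j` are in different trees of the first one, only `j` and a vertex other than `c` can share both
trees. -/
theorem isForbidden_iff_exists_mem_sharingPairs (hv : Function.Injective v) {c j : Fin (k + 1)}
    (hjc : j ≠ c) {p : SimpleGraph V × SimpleGraph V}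
    (hp : p ∈ sharingPairs G (Finset.univ.image v) (v c) (v j) (v j)) :
    IsForbidden v p.1 p.2 ↔ ∃ a, a ≠ c ∧ a ≠ j ∧
      p ∈ sharingPairs G (Finset.univ.image v) (v c) (v j) (v a) := by
  obtain ⟨-, -, hcj, hsep⟩ := (mem_sharingPairs_self_iff hv hjc).1 hp
  have mem_of_reachable {a} (h₁ : p.1.Reachable (v j) (v a)) (h₂ : p.2.Reachable (v j) (v a))
      (haj : a ≠ j) : ∃ a, a ≠ c ∧ a ≠ j ∧
        p ∈ sharingPairs G (Finset.univ.image v) (v c) (v j) (v a) :=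
    ⟨a, fun hac => hcj (hac ▸ h₁.symm), haj, ⟨hp.1.1, h₁⟩, hp.2.1, h₂⟩
  constructor
  · rintro ⟨a, b, hab, h₁, h₂⟩
    by_cases haj : a = j
    · subst haj
      exact mem_of_reachable h₁ h₂ hab.symm
    · by_cases hbj : b = j
      · subst hbj
        exact mem_of_reachable h₁.symm h₂.symm hab
      · exact absurd h₂ (hsep a b haj hbj hab)
  · rintro ⟨a, -, haj, h⟩
    exact ⟨j, a, haj.symm, h.1.2, h.2.2⟩

theorem rightPairs_eq_sdiff (hv : Function.Injective v) (c : Fin (k + 1)) (j : Fin k) :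
    rightPairs G v c (c.succAbove j) =
      sharingPairs G (Finset.univ.image v) (v c) (v (c.succAbove j)) (v (c.succAbove j)) \
        ⋃ i ∈ Finset.univ.erase j,
          sharingPairs G (Finset.univ.image v) (v c) (v (c.succAbove j)) (v (c.succAbove i)) := by
  ext p
  have mem_iUnion : (p ∈ ⋃ i ∈ Finset.univ.erase j,
      sharingPairs G (Finset.univ.image v) (v c) (v (c.succAbove j)) (v (c.succAbove i))) ↔
      ∃ a, a ≠ c ∧ a ≠ c.succAbove j ∧
        p ∈ sharingPairs G (Finset.univ.image v) (v c) (v (c.succAbove j)) (v a) := by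
    simp only [Set.mem_iUnion, Finset.mem_erase, Finset.mem_univ, and_true, exists_prop,
      Fin.exists_iff_succAbove c, ne_eq, not_true, false_and, Fin.succAbove_ne, not_false_eq_true,
      true_and, Fin.succAbove_right_inj, false_or]
  have hjc := Fin.succAbove_ne c j
  rw [Set.mem_sdiff, mem_iUnion, ← and_congr_right fun hp =>
    not_congr (isForbidden_iff_exists_mem_sharingPairs hv hjc hp),
    mem_sharingPairs_self_iff hv hjc, rightPairs, Set.mem_ofPred_eq]
  tauto

end SharingPairs

section AdjugateMinors

variable {V ι R : Type*} [Fintype V] [DecidableEq V] [Fintype ι] [DecidableEq ι] [CommRing R]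
  {G : SimpleGraph V} {m : ℕ} {S : Finset V} {t : Fin m → ι} {e : ι → V} {c : V}

theorem adjugate_mul_det_submatrix_vecCons_self (w : Sym2 V → R)
    (he : Function.Injective e) (hrange : Set.range e = {c}ᶜ) (ht : Function.Injective t)
    (hS : Set.range (e ∘ t) = (S : Set V)ᶜ) {j : ι} (hj : e j ∈ S) :
    ((weightedLaplacian G w).submatrix e e).adjugate j j *
      (((weightedLaplacian G w).submatrix e e).submatrix
        (Matrix.vecCons j t) (Matrix.vecCons j t)).det =
      pairSum w (sharingPairs G S c (e j) (e j)) := by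
  rw [adjugate_submatrix_weightedLaplacian G w he (by rw [hrange, Finset.coe_singleton]),
    Matrix.submatrix_submatrix, Matrix.vecCons, Fin.comp_cons, ← Matrix.vecCons,
    det_submatrix_vecCons_self_weightedLaplacian G w (he.comp ht) hS hj, forestSum_mul_forestSum]
  simp only [sharingPairs, SimpleGraph.Reachable.refl, and_true]

theorem adjugate_mul_det_submatrix_vecCons_of_ne (w : Sym2 V → R)
    (he : Function.Injective e) (hrange : Set.range e = {c}ᶜ) (ht : Function.Injective t)
    (hS : Set.range (e ∘ t) = (S : Set V)ᶜ) {i j : ι} (hi : e i ∈ S) (hj : e j ∈ S) (hij : i ≠ j) :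
    ((weightedLaplacian G w).submatrix e e).adjugate j i *
      (((weightedLaplacian G w).submatrix e e).submatrix
        (Matrix.vecCons i t) (Matrix.vecCons j t)).det =
      -pairSum w (sharingPairs G S c (e j) (e i)) := by
  rw [adjugate_submatrix_weightedLaplacian G w he (by rw [hrange, Finset.coe_singleton]),
    Matrix.submatrix_submatrix, Matrix.vecCons, Matrix.vecCons, Fin.comp_cons, Fin.comp_cons,
    ← Matrix.vecCons, ← Matrix.vecCons,
    det_submatrix_vecCons_weightedLaplacian_of_ne G w (he.comp ht) hS hi hj (he.ne hij), mul_neg,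
    forestSum_mul_forestSum, sharingPairs]

end AdjugateMinors

section MarkedVertices

variable {V R : Type*} {G : SimpleGraph V} {n k : ℕ} {v : Fin (k + 1) → V} {c : Fin (k + 1)}
  {e : Fin n → V}

theorem injective_of_comp_castLE (hk : k ≤ n) (he : Function.Injective e)
    (hrange : Set.range e = {v c}ᶜ) (hev : ∀ i, e (Fin.castLE hk i) = v (c.succAbove i)) :
    Function.Injective v := by
  have ne_marked (i : Fin k) : v (c.succAbove i) ≠ v c :=
    hev i ▸ hrange.le (Set.mem_range_self (Fin.castLE hk i))
  intro a b hab
  obtain ha | ⟨i, rfl⟩ := Fin.eq_self_or_eq_succAbove c a <;>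
    obtain hb | ⟨i', rfl⟩ := Fin.eq_self_or_eq_succAbove c b
  · exact ha.trans hb.symm
  · exact absurd (ha ▸ hab).symm (ne_marked i')
  · exact absurd (hb ▸ hab) (ne_marked i)
  · rw [← hev, ← hev] at hab
    rw [Fin.castLE_injective hk (he hab)]

theorem range_comp_tailIdx [DecidableEq V] (hk : k ≤ n) (he : Function.Injective e)
    (hrange : Set.range e = {v c}ᶜ) (hev : ∀ i, e (Fin.castLE hk i) = v (c.succAbove i)) :
    Set.range (e ∘ tailIdx hk) = (Finset.univ.image v : Set V)ᶜ := by
  have image_firstIdx : e '' firstIdx hk = v '' {c}ᶜ := by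
    rw [firstIdx, Finset.coe_map, Finset.coe_univ, Set.image_univ, ← Fin.range_succAbove,
      ← Set.range_comp, ← Set.range_comp]
    exact congrArg Set.range (funext hev)
  rw [Set.range_comp, range_tailIdx, Set.image_compl_eq_range_sdiff_image he, hrange,
    image_firstIdx, Finset.coe_image, Finset.coe_univ, Set.image_univ,
    ← Set.insert_image_compl_eq_range v c, Set.insert_eq, Set.compl_union, Set.sdiff_eq]

variable [Fintype V] [DecidableEq V] [CommRing R]

theorem columnExpansionLeft_eq_pairSum_leftPairs (hk : k ≤ n) (w : Sym2 V → R)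
    (he : Function.Injective e) (hrange : Set.range e = {v c}ᶜ)
    (hev : ∀ i, e (Fin.castLE hk i) = v (c.succAbove i)) :
    columnExpansionLeft hk ((weightedLaplacian G w).submatrix e e) =
      pairSum w (leftPairs G v) := by
  have hv := injective_of_comp_castLE hk he hrange hev
  change _ * (((weightedLaplacian G w).submatrix e e).submatrix (tailIdx hk) (tailIdx hk)).det = _
  rw [Matrix.submatrix_submatrix,
    det_submatrix_weightedLaplacian G w he (by rw [hrange, Finset.coe_singleton]),
    det_submatrix_weightedLaplacian G w (he.comp (tailIdx hk).injective)
      (range_comp_tailIdx hk he hrange hev), forestSum_mul_forestSum, leftPairs_eq_prod hv (v c)]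

theorem columnExpansionRight_eq_pairSum_rightPairs (hk : k ≤ n) (w : Sym2 V → R)
    (he : Function.Injective e) (hrange : Set.range e = {v c}ᶜ)
    (hev : ∀ i, e (Fin.castLE hk i) = v (c.succAbove i)) (j : Fin k) :
    columnExpansionRight hk ((weightedLaplacian G w).submatrix e e) j =
      pairSum w (rightPairs G v c (c.succAbove j)) := by
  have hv := injective_of_comp_castLE hk he hrange hev
  have htail := range_comp_tailIdx hk he hrange hev
  have hmem (i : Fin k) : e (Fin.castLE hk i) ∈ Finset.univ.image v :=
    hev i ▸ Finset.mem_image_of_mem v (Finset.mem_univ _)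
  have hmem_erase (i) (hi : i ∈ Finset.univ.erase j) :
      v (c.succAbove i) ∈ (Finset.univ.image v).erase (v (c.succAbove j)) :=
    Finset.mem_erase.2 ⟨hv.ne (Fin.succAbove_right_injective.ne (Finset.ne_of_mem_erase hi)),
      Finset.mem_image_of_mem v (Finset.mem_univ _)⟩
  rw [columnExpansionRight_eq_sum_adjugate, ← Finset.add_sum_erase _ _ (Finset.mem_univ j),
    rightPairs_eq_sdiff hv, pairSum_sdiff_biUnion, sub_eq_add_neg, ← Finset.sum_neg_distrib]
  · congr 1
    · rw [adjugate_mul_det_submatrix_vecCons_self w he hrange (tailIdx hk).injective htail (hmem j),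
        hev]
    · refine Finset.sum_congr rfl fun i hi => ?_
      rw [adjugate_mul_det_submatrix_vecCons_of_ne w he hrange (tailIdx hk).injective htail (hmem i)
        (hmem j) ((Fin.castLE_injective hk).ne (Finset.ne_of_mem_erase hi)), hev, hev]
  · exact fun i _ => sharingPairs_subset_self
  · exact fun i hi i' hi' hii' => disjoint_sharingPairs (hmem_erase i hi) (hmem_erase i' hi')
      (hv.ne (Fin.succAbove_right_injective.ne hii'))

end MarkedVertices

theorem succAbove_castLE_castLE {n k : ℕ} (hk : k ≤ n) (c : Fin (k + 1)) (i : Fin k) :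
    (Fin.castLE (Nat.succ_le_succ hk) c).succAbove (Fin.castLE hk i) =
      Fin.castLE (Nat.succ_le_succ hk) (c.succAbove i) := by
  ext
  simp only [Fin.succAbove, Fin.lt_def, Fin.val_castSucc, Fin.val_castLE]
  split_ifs <;> rfl

theorem proposition2p6_general {V R : Type*} [Fintype V] [DecidableEq V] [CommRing R] {n k : ℕ}
    (hk : k ≤ n) (G : SimpleGraph V) (w : Sym2 V → R) (v : Fin (k + 1) → V) (c : Fin (k + 1))
    (e : Fin n → V) (he : Function.Injective e) (hrange : Set.range e = {v c}ᶜ)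
    (hev : ∀ i, e (Fin.castLE hk i) = v (c.succAbove i)) (j : Fin k) :
    columnExpansionLeft hk ((weightedLaplacian G w).submatrix e e) = pairSum w (leftPairs G v) ∧
    columnExpansionRight hk ((weightedLaplacian G w).submatrix e e) j =
      pairSum w (rightPairs G v c (c.succAbove j)) ∧
    columnExpansionLeft hk ((weightedLaplacian G w).submatrix e e) =
      columnExpansionRight hk ((weightedLaplacian G w).submatrix e e) j :=
  ⟨columnExpansionLeft_eq_pairSum_leftPairs hk w he hrange hev,
    columnExpansionRight_eq_pairSum_rightPairs hk w he hrange hev j,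
    columnExpansionLeft_eq_columnExpansionRight hk _ j⟩

/-- The vertices of `G` are `Fin (n + 1)`, the marked ones are the first `k + 1`, and `M` is the
Laplacian with the row and the column of the marked vertex `c` removed. The index `j'` is the
position of the column of the marked vertex `j ≠ c` in `M`. -/
theorem proposition2p6 {R : Type*} [CommRing R] {n k : ℕ} (hk : k ≤ n)
    (G : SimpleGraph (Fin (n + 1))) (w : Sym2 (Fin (n + 1)) → R)
    (c j : Fin (k + 1)) (j' : Fin k) (hj : c.succAbove j' = j)
    (v : Fin (k + 1) → Fin (n + 1)) (hv : v = Fin.castLE (Nat.succ_le_succ hk))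
    (M : Matrix (Fin n) (Fin n) R)
    (hM : M = (weightedLaplacian G w).submatrix (v c).succAbove (v c).succAbove) :
    columnExpansionLeft hk M = pairSum w (leftPairs G v) ∧
    columnExpansionRight hk M j' = pairSum w (rightPairs G v c j) ∧
    columnExpansionLeft hk M = columnExpansionRight hk M j' := by
  subst hj hv hM
  exact proposition2p6_general hk G w _ c _ Fin.succAbove_right_injective
    (Fin.range_succAbove _) (succAbove_castLE_castLE hk c) j'
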